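/- Let $(R,\mathfrak m)$ be either (a) a noetherian local ring with maximal ideal $\mathfrak m$, or (b) a standard graded algebra over a field $k$ (that is, $R=\bigoplus_{n\ge 0}R_n$ is commutative, $R_0=k$, and $R$ is generated as a $k$-algebra by the finite-dimensional space $R_1$) with graded maximal ideal $\mathfrak m=\bigoplus_{n\ge 1}R_n$. In case (b) all modules are $\mathbb Z$-graded and all maps between them are homogeneous of degree $0$. For a finitely generated $R$-module $M$ let $F$ be its minimal (in case (b): minimal graded) free resolution, filtered by the subcomplexes $(\mathcal G^nF)_i=\mathfrak m^{\,n-i}F_i$, where $\mathfrak m^j=R$ for $j\le 0$. Let $\operatorname{lin}^RF=\bigoplus_n \mathcal G^nF/\mathcal G^{n+1}F$ be the associated graded complex. The linearity defect of $M$ is $\operatorname{ld}_R M=\sup\{i: H_i(\operatorname{lin}^RF)\ne 0\}\in\mathbb N\cup\{\infty\}$, with $\operatorname{ld}_R 0=0$. The module $M$ is called Koszul if $\operatorname{ld}_RM=0$. **Theorem.** Let $0\to M'\to P'\to N'\to 0$ be a short exact sequence of non-zero finitely generated $R$-modules such that $M'$ is a Koszul module and $M'\cap\mathfrak mP'=\mathfrak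 mM'$. Then $$\operatorname{ld}_RP'\le \operatorname{ld}_RN'\le\max\{\operatorname{ld}_RP',1\}.$$ In particular, $\operatorname{ld}_RN'=\operatorname{ld}_RP'$ if $\operatorname{ld}_RP'\ge 1$, and $\operatorname{ld}_RN'\le 1$ if $\operatorname{ld}_RP'=0$. Moreover, $\operatorname{ld}_RN'=0$ if and only if $P'$ is a Koszul module and $M'\cap\mathfrak m^sP'=\mathfrak m^sM'$ for all $s\ge 1$. -/

import Mathlib

open CategoryTheory

universe u v w

/-! Minimal free resolutions, written with coordinates: `F_i = R^(rank i)`. -/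

/-- A minimal free resolution `⋯ → F₁ → F₀ → M → 0` of an `R`-module `M`, with respect to an
ideal `𝔪`, by free modules `F_i = R^(rank i)` of finite rank: the augmented complex is exact and
each differential maps `F_(i+1)` into `𝔪 F_i`. -/
structure MinimalFreeResolution {R : Type u} [CommRing R] (𝔪 : Ideal R)
    (M : Type v) [AddCommGroup M] [Module R M] where
  rank : ℕ → ℕ
  d : ∀ i, (Fin (rank (i + 1)) → R) →ₗ[R] (Fin (rank i) → R)
  aug : (Fin (rank 0) → R) →ₗ[R] M
  aug_surjective : Function.Surjective aug
  exact_zero : LinearMap.range (d 0) = LinearMap.ker aug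
  exact_succ : ∀ i, LinearMap.range (d (i + 1)) = LinearMap.ker (d i)
  minimal : ∀ i, LinearMap.range (d i) ≤ 𝔪 • (⊤ : Submodule R (Fin (rank i) → R))

namespace MinimalFreeResolution

variable {R : Type u} [CommRing R] {𝔪 : Ideal R} {M : Type v} [AddCommGroup M] [Module R M]

/-- The filtration `(𝒢ⁿF)_i = 𝔪^(n-i) F_i`, where `𝔪^j = R` for `j ≤ 0` (this is what the
truncated subtraction of natural numbers gives). -/
def filt (F : MinimalFreeResolution 𝔪 M) (n i : ℕ) : Submodule R (Fin (F.rank i) → R) :=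
  𝔪 ^ (n - i) • ⊤

lemma d_mem_filt (F : MinimalFreeResolution 𝔪 M) (n i : ℕ) :
    ∀ x ∈ F.filt n (i + 1), F.d i x ∈ F.filt n i := by
  have h : (F.filt n (i + 1)).map (F.d i) ≤ F.filt n i := by
    unfold filt
    rw [Submodule.map_smul'', Submodule.map_top]
    refine (Submodule.smul_mono le_rfl (F.minimal i)).trans ?_
    rw [← Submodule.mul_smul, ← pow_succ]
    exact Submodule.smul_mono_left (Ideal.pow_le_pow_right (by omega))
  intro x hx
  exact h (Submodule.mem_map_of_mem hx)

/-- The graded piece `(𝒢ⁿF)_i / (𝒢ⁿ⁺¹F)_i`. -/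
def Gr (F : MinimalFreeResolution 𝔪 M) (n i : ℕ) : Type u :=
  F.filt n i ⧸ (F.filt (n + 1) i).submoduleOf (F.filt n i)

instance (F : MinimalFreeResolution 𝔪 M) (n i : ℕ) : AddCommGroup (F.Gr n i) :=
  inferInstanceAs (AddCommGroup (F.filt n i ⧸ (F.filt (n + 1) i).submoduleOf (F.filt n i)))

instance (F : MinimalFreeResolution 𝔪 M) (n i : ℕ) : Module R (F.Gr n i) :=
  inferInstanceAs (Module R (F.filt n i ⧸ (F.filt (n + 1) i).submoduleOf (F.filt n i)))

/-- The map `(𝒢ⁿF)_(i+1) / (𝒢ⁿ⁺¹F)_(i+1) → (𝒢ⁿF)_i / (𝒢ⁿ⁺¹F)_i` induced by the differential. -/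
def grD (F : MinimalFreeResolution 𝔪 M) (n i : ℕ) : F.Gr n (i + 1) →ₗ[R] F.Gr n i :=
  Submodule.mapQ _ _ ((F.d i).restrict (F.d_mem_filt n i))
    (fun x hx => F.d_mem_filt (n + 1) i x.1 hx)

lemma grD_comp_grD (F : MinimalFreeResolution 𝔪 M) (n i : ℕ) :
    F.grD n i ∘ₗ F.grD n (i + 1) = 0 := by
  refine LinearMap.ext fun y => ?_
  obtain ⟨x, rfl⟩ := Submodule.Quotient.mk_surjective _ y
  have h : F.d i (F.d (i + 1) x.1) = 0 := by
    have : F.d (i + 1) x.1 ∈ LinearMap.range (F.d (i + 1)) := ⟨_, rfl⟩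
    rwa [F.exact_succ] at this
  have h' : (F.d i).restrict (F.d_mem_filt n i)
      ((F.d (i + 1)).restrict (F.d_mem_filt n (i + 1)) x) = 0 := Subtype.ext h
  exact congrArg (Submodule.Quotient.mk (p := (F.filt (n + 1) i).submoduleOf (F.filt n i))) h'

/-- The linear part of `F`: the associated graded complex `⨁ₙ 𝒢ⁿF / 𝒢ⁿ⁺¹F`. -/
noncomputable def linPart (F : MinimalFreeResolution 𝔪 M) : ChainComplex (ModuleCat.{u} R) ℕ :=
  ChainComplex.of (fun i => ModuleCat.of R (DirectSum ℕ fun n => F.Gr n i))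
    (fun i => ModuleCat.ofHom (DirectSum.lmap fun n => F.grD n i))
    (fun i => by
      rw [← ModuleCat.ofHom_comp, ← DirectSum.lmap_comp]
      have h : (fun n => F.grD n i ∘ₗ F.grD n (i + 1)) = fun n => 0 :=
        funext fun n => F.grD_comp_grD n i
      rw [h]
      ext : 1
      refine DirectSum.linearMap_ext R fun n => ?_
      ext x
      simp [DirectSum.lmap_lof])

/-- `sup {i | H_i(lin F) ≠ 0}`, with value `0` if all the homology vanishes. -/
noncomputable def linDefect (F : MinimalFreeResolution 𝔪 M) : ℕ∞ :=
  sSup {t : ℕ∞ | ∃ i : ℕ, t = i ∧ ¬ Limits.IsZero (F.linPart.homology i)}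

end MinimalFreeResolution

/-! Existence of minimal free resolutions: facts shared by the local and the graded case. -/

lemma exists_smaller_of_isUnit {R : Type u} [CommRing R] {M : Type v} [AddCommGroup M]
    [Module R M] {b : ℕ} (g : Fin (b + 1) → M) (x : Fin (b + 1) → R) (j : Fin (b + 1))
    (hj : IsUnit (x j)) (hx : ∑ l, x l • g l = 0) :
    Submodule.span R (Set.range (g ∘ j.succAbove)) = Submodule.span R (Set.range g) := by
  apply le_antisymm
  · exact Submodule.span_mono (Set.range_comp_subset_range _ _)
  · rw [Submodule.span_le]
    rintro _ ⟨l, rfl⟩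
    rcases Fin.eq_self_or_eq_succAbove j l with rfl | ⟨l', rfl⟩
    · rw [Fin.sum_univ_succAbove _ l] at hx
      obtain ⟨c, hc⟩ := hj
      have h1 : (c : R) • g l ∈ Submodule.span R (Set.range (g ∘ l.succAbove)) := by
        rw [hc, eq_neg_of_add_eq_zero_left hx]
        refine Submodule.neg_mem _ (Submodule.sum_mem _ fun i _ => Submodule.smul_mem _ _ ?_)
        exact Submodule.subset_span ⟨i, rfl⟩
      have h2 := Submodule.smul_mem _ ((c⁻¹ : Rˣ) : R) h1
      rwa [smul_smul, Units.inv_mul, one_smul] at h2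
    · exact Submodule.subset_span ⟨l', rfl⟩

lemma mem_smul_top_of_forall_mem {R : Type u} [CommRing R] {𝔪 : Ideal R} {b : ℕ}
    (x : Fin b → R) (hx : ∀ l, x l ∈ 𝔪) : x ∈ 𝔪 • (⊤ : Submodule R (Fin b → R)) := by
  have h : x = ∑ l, x l • (Pi.single l 1 : Fin b → R) := by
    ext i
    simp [Finset.sum_apply, Pi.single_apply]
  rw [h]
  exact Submodule.sum_mem _ fun l _ => Submodule.smul_mem_smul (hx l) trivial

/-- Iterating a one-step construction of minimal covers. The degrees and the conditions `Good`
and `Hom` are only used in the graded case. -/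
lemma exists_resolution_of_step {R : Type u} [CommRing R] (𝔪 : Ideal R)
    {M : Type v} [AddCommGroup M] [Module R M]
    (Good : ∀ b : ℕ, (Fin b → ℤ) → Submodule R (Fin b → R) → Prop)
    (Hom : ∀ b b' : ℕ, (Fin b' → ℤ) → (Fin b → ℤ) → ((Fin b' → R) →ₗ[R] (Fin b → R)) → Prop)
    (step : ∀ b deg K, Good b deg K → ∃ (b' : ℕ) (deg' : Fin b' → ℤ)
      (f : (Fin b' → R) →ₗ[R] (Fin b → R)), LinearMap.range f = K ∧
      (∀ x ∈ LinearMap.ker f, ∀ l, x l ∈ 𝔪) ∧ Hom b b' deg' deg f ∧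
      Good b' deg' (LinearMap.ker f))
    (b₀ : ℕ) (deg₀ : Fin b₀ → ℤ) (f₀ : (Fin b₀ → R) →ₗ[R] M)
    (hs : Function.Surjective f₀) (hm : ∀ x ∈ LinearMap.ker f₀, ∀ l, x l ∈ 𝔪)
    (hg : Good b₀ deg₀ (LinearMap.ker f₀)) :
    ∃ (F : MinimalFreeResolution 𝔪 M) (deg : ∀ i, Fin (F.rank i) → ℤ)
      (h₀ : F.rank 0 = b₀), (∀ j, deg 0 j = deg₀ (Fin.cast h₀ j)) ∧
      (∀ x, F.aug x = f₀ (fun j => x (Fin.cast h₀.symm j))) ∧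
      ∀ i, Hom _ _ (deg (i + 1)) (deg i) (F.d i) := by
  choose nb nd nf h1 h2 h3 h4 using step
  let T := Σ (b : ℕ) (deg : Fin b → ℤ),
    {K : Submodule R (Fin b → R) // Good b deg K ∧ ∀ x ∈ K, ∀ l, x l ∈ 𝔪}
  let nxt : T → T := fun t => ⟨nb t.1 t.2.1 t.2.2.1 t.2.2.2.1, nd t.1 t.2.1 t.2.2.1 t.2.2.2.1,
    LinearMap.ker (nf t.1 t.2.1 t.2.2.1 t.2.2.2.1), h4 _ _ _ _, h2 _ _ _ _⟩
  let s : ℕ → T := fun i => Nat.rec ⟨b₀, deg₀, LinearMap.ker f₀, hg, hm⟩ (fun _ t => nxt t) i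
  refine ⟨{ rank := fun i => (s i).1
            d := fun i => nf (s i).1 (s i).2.1 (s i).2.2.1 (s i).2.2.2.1
            aug := f₀
            aug_surjective := hs
            exact_zero := h1 _ _ _ _
            exact_succ := fun i => h1 _ _ _ _
            minimal := fun i => ?_ }, fun i => (s i).2.1, rfl, fun j => rfl, fun x => rfl,
            fun i => h3 _ _ _ _⟩
  rw [h1]
  intro x hx
  exact mem_smul_top_of_forall_mem x ((s i).2.2.2.2 x hx)

/-! The local case. -/

lemma IsLocalRing.exists_minimal_cover {R : Type u} [CommRing R] [IsLocalRing R]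
    {M : Type v} [AddCommGroup M] [Module R M] (K : Submodule R M) (hK : K.FG) :
    ∃ (b : ℕ) (f : (Fin b → R) →ₗ[R] M), LinearMap.range f = K ∧
      ∀ x ∈ LinearMap.ker f, ∀ l, x l ∈ IsLocalRing.maximalIdeal R := by
  classical
  have hex : ∃ b : ℕ, ∃ g : Fin b → M, Submodule.span R (Set.range g) = K :=
    Submodule.fg_iff_exists_fin_generating_family.mp hK
  obtain ⟨g, hg⟩ := Nat.find_spec hex
  have hmin := fun c (hc : c < Nat.find hex) => Nat.find_min hex hc
  generalize Nat.find hex = b at g hg hmin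
  refine ⟨b, Fintype.linearCombination R g, by rw [Fintype.range_linearCombination, hg], ?_⟩
  intro x hx l
  by_contra hl
  have hu : IsUnit (x l) := by simpa using hl
  rcases b with _ | b
  · exact l.elim0
  · refine hmin b (Nat.lt_succ_self b) ⟨g ∘ l.succAbove, ?_⟩
    rw [exists_smaller_of_isUnit g x l hu
      (by simpa [Fintype.linearCombination_apply] using hx), hg]

theorem nonempty_minimalFreeResolution (R : Type u) [CommRing R] [IsLocalRing R]
    [IsNoetherianRing R] (M : Type v) [AddCommGroup M] [Module R M] [Module.Finite R M] :
    Nonempty (MinimalFreeResolution (IsLocalRing.maximalIdeal R) M) := by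
  obtain ⟨b, f, hf, hm⟩ := IsLocalRing.exists_minimal_cover (⊤ : Submodule R M) Module.Finite.fg_top
  obtain ⟨F, -⟩ := exists_resolution_of_step (IsLocalRing.maximalIdeal R) (M := M)
    (fun _ _ _ => True) (fun _ _ _ _ _ => True)
    (fun b deg K _ => by
      obtain ⟨b', f, h1, h2⟩ := IsLocalRing.exists_minimal_cover K (IsNoetherian.noetherian K)
      exact ⟨b', fun _ => 0, f, h1, h2, trivial, trivial⟩)
    b (fun _ => 0) f (LinearMap.range_eq_top.mp hf) hm trivial
  exact ⟨F⟩

/-- The linearity defect `ld_R M` of a finitely generated module over a noetherian local ring,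
computed from the minimal free resolution of `M`. -/
noncomputable def lind (R : Type u) [CommRing R] [IsLocalRing R] [IsNoetherianRing R]
    (M : Type v) [AddCommGroup M] [Module R M] [Module.Finite R M] : ℕ∞ :=
  (Classical.choice (nonempty_minimalFreeResolution R M)).linDefect

/-- Koszul modules over a noetherian local ring. -/
def IsKoszulModule (R : Type u) [CommRing R] [IsLocalRing R] [IsNoetherianRing R]
    (M : Type v) [AddCommGroup M] [Module R M] [Module.Finite R M] : Prop :=
  lind R M = 0

/-! The graded case. -/

/-- `R = ⨁ₙ 𝒜 n` is a standard graded algebra over the field `k`: the degree zero part is `k`,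
and `R` is generated as a `k`-algebra by the finite dimensional space `𝒜 1`. -/
class IsStandardGraded {k : Type w} {R : Type u} [Field k] [CommRing R] [Algebra k R]
    (𝒜 : ℕ → Submodule k R) [GradedAlgebra 𝒜] : Prop where
  nontrivial : Nontrivial R
  degree_zero : 𝒜 0 = 1
  finite_degree_one : Module.Finite k (𝒜 1)
  adjoin_degree_one : Algebra.adjoin k (𝒜 1 : Set R) = ⊤

/-- `M = ⨁_{d ∈ ℤ} ℳ d` is a graded module over `R = ⨁ₙ 𝒜 n`. -/
class IsGradedModule {k : Type w} {R : Type u} [Field k] [CommRing R] [Algebra k R]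
    (𝒜 : ℕ → Submodule k R) {M : Type v} [AddCommGroup M] [Module R M]
    (ℳ : ℤ → AddSubgroup M) : Prop where
  isInternal : DirectSum.IsInternal ℳ
  smul_mem : ∀ (n : ℕ) (d : ℤ) (a : R) (m : M), a ∈ 𝒜 n → m ∈ ℳ d → a • m ∈ ℳ (n + d)

/-- The graded maximal ideal `⨁_{n ≥ 1} 𝒜 n`. -/
noncomputable abbrev gradedMaximalIdeal {k : Type w} {R : Type u} [Field k] [CommRing R]
    [Algebra k R] (𝒜 : ℕ → Submodule k R) [GradedAlgebra 𝒜] : Ideal R :=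
  (HomogeneousIdeal.irrelevant 𝒜).toIdeal

/-- The homogeneous part of `R` of degree `e ∈ ℤ`, which is zero for `e < 0`. -/
def degreePart {k : Type w} {R : Type u} [Field k] [CommRing R] [Algebra k R]
    (𝒜 : ℕ → Submodule k R) : ℤ → Submodule k R
  | Int.ofNat n => 𝒜 n
  | Int.negSucc _ => ⊥

/-- A minimal graded free resolution of a graded module: `F_i` is the direct sum of the shifted
modules `R(-deg i j)`, that is, its `j`-th basis vector has degree `deg i j`, and the
differentials and the augmentation are homogeneous of degree zero. -/
structure GradedMinimalFreeResolution {k : Type w} {R : Type u} [Field k] [CommRing R]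
    [Algebra k R] (𝒜 : ℕ → Submodule k R) [GradedAlgebra 𝒜] {M : Type v} [AddCommGroup M]
    [Module R M] (ℳ : ℤ → AddSubgroup M) extends
    MinimalFreeResolution (gradedMaximalIdeal 𝒜) M where
  deg : ∀ i, Fin (rank i) → ℤ
  d_homogeneous : ∀ i j l, d i (Pi.single j 1) l ∈ degreePart 𝒜 (deg (i + 1) j - deg i l)
  aug_homogeneous : ∀ j, aug (Pi.single j 1) ∈ ℳ (deg 0 j)

section GradedExistence

variable {k : Type w} {R : Type u} [Field k] [CommRing R] [Algebra k R]
  (𝒜 : ℕ → Submodule k R) [GradedAlgebra 𝒜]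

/-- Projection of `R` onto its part of degree `e ∈ ℤ`. -/
noncomputable def degreeProj : ℤ → R →+ R
  | Int.ofNat n => GradedRing.proj 𝒜 n
  | Int.negSucc _ => 0

lemma degreeProj_mem (e : ℤ) (r : R) : degreeProj 𝒜 e r ∈ degreePart 𝒜 e := by
  rcases e with n | n
  · exact SetLike.coe_mem _
  · exact Submodule.zero_mem _

lemma degreeProj_of_mem (e e' : ℤ) (r : R) (hr : r ∈ degreePart 𝒜 e') :
    degreeProj 𝒜 e r = if e = e' then r else 0 := by
  rcases e' with n' | n'
  · rcases e with n | n
    · change ((DirectSum.decompose 𝒜 r n : 𝒜 n) : R) = _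
      split_ifs with h
      · have h' : n = n' := by simpa using h
        subst h'
        exact DirectSum.decompose_of_mem_same 𝒜 hr
      · exact DirectSum.decompose_of_mem_ne 𝒜 hr (fun h' => h (by rw [h']))
    · simp [degreeProj]
  · have h0 : r = 0 := by simpa [degreePart] using hr
    simp [h0]

lemma sum_degreeProj (r : R) : ∃ N : ℕ, ∀ N' ≥ N,
    r = ∑ n ∈ Finset.range N', degreeProj 𝒜 (n : ℤ) r := by
  classical
  refine ⟨(DirectSum.decompose 𝒜 r).support.sup id + 1, fun N' hN' => ?_⟩
  conv_lhs => rw [← DirectSum.sum_support_decompose 𝒜 r]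
  refine Finset.sum_subset (fun n hn => ?_) (fun n _ hn => ?_)
  · have : n ≤ (DirectSum.decompose 𝒜 r).support.sup id := Finset.le_sup (f := id) hn
    simp only [Finset.mem_range]
    omega
  · simpa using hn

/-- The degree `d` part of the free module with basis in degrees `deg`. -/
def freePart {b : ℕ} (deg : Fin b → ℤ) (d : ℤ) : AddSubgroup (Fin b → R) where
  carrier := {x | ∀ l, x l ∈ degreePart 𝒜 (d - deg l)}
  add_mem' := fun hx hy l => Submodule.add_mem _ (hx l) (hy l)
  zero_mem' := fun _ => Submodule.zero_mem _
  neg_mem' := fun hx l => Submodule.neg_mem _ (hx l)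

/-- Projection onto the degree `d` part of a graded free module. -/
noncomputable def freeProj {b : ℕ} (deg : Fin b → ℤ) (d : ℤ) : (Fin b → R) →+ (Fin b → R) where
  toFun := fun x l => degreeProj 𝒜 (d - deg l) (x l)
  map_zero' := by ext; simp
  map_add' := fun x y => by ext; simp

lemma exists_graded_cover [IsStandardGraded 𝒜] {M : Type v} [AddCommGroup M] [Module R M]
    (𝒢 : ℤ → AddSubgroup M) (π : ℤ → M →+ M)
    (hπ : ∀ d e m, m ∈ 𝒢 e → π d m = if d = e then m else 0)
    (hsmul : ∀ (n : ℕ) (d : ℤ) (a : R) (m : M), a ∈ 𝒜 n → m ∈ 𝒢 d → a • m ∈ 𝒢 (n + d))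
    (K : Submodule R M) (hK : K.FG)
    (hKh : Submodule.span R {m | m ∈ K ∧ ∃ d, m ∈ 𝒢 d} = K) :
    ∃ (b : ℕ) (deg : Fin b → ℤ) (f : (Fin b → R) →ₗ[R] M), LinearMap.range f = K ∧
      (∀ x ∈ LinearMap.ker f, ∀ l, x l ∈ gradedMaximalIdeal 𝒜) ∧
      (∀ j, f (Pi.single j 1) ∈ 𝒢 (deg j)) ∧
      Submodule.span R {x | x ∈ LinearMap.ker f ∧ ∃ d, x ∈ freePart 𝒜 deg d} =
        LinearMap.ker f := by
  classical
  have hex : ∃ b : ℕ, ∃ (g : Fin b → M), (∀ j, ∃ d, g j ∈ 𝒢 d) ∧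
      Submodule.span R (Set.range g) = K := by
    rw [← hKh] at hK
    obtain ⟨t, ht, hts⟩ := (Submodule.fg_span_iff_fg_span_finset_subset _).mp hK
    refine ⟨t.card, fun j => (t.equivFin.symm j : M), fun j => ?_, ?_⟩
    · exact (ht (t.equivFin.symm j).2).2
    · have : Set.range (fun j => (t.equivFin.symm j : M)) = (t : Set M) := by
        ext m
        constructor
        · rintro ⟨j, rfl⟩
          exact (t.equivFin.symm j).2
        · intro hm
          exact ⟨t.equivFin ⟨m, hm⟩, by simp⟩
      rw [this, ← hts, hKh]
  obtain ⟨g, hgd, hg⟩ := Nat.find_spec hex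
  have hmin := fun c (hc : c < Nat.find hex) => Nat.find_min hex hc
  generalize Nat.find hex = b at g hgd hg hmin
  choose deg hdeg using hgd
  have hterm : ∀ (d : ℤ) (l : Fin b) (r : R),
      π d (r • g l) = degreeProj 𝒜 (d - deg l) r • g l := by
    intro d l r
    obtain ⟨N, hN⟩ := sum_degreeProj 𝒜 r
    have hr := hN N le_rfl
    have hpiece : ∀ n : ℕ, π d (degreeProj 𝒜 (n : ℤ) r • g l) =
        if d = n + deg l then degreeProj 𝒜 (n : ℤ) r • g l else 0 := fun n =>
      hπ d _ _ (hsmul n (deg l) _ _ (degreeProj_mem 𝒜 (n : ℤ) r) (hdeg l))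
    have hL : π d (r • g l) = ∑ n ∈ Finset.range N,
        if d = n + deg l then degreeProj 𝒜 (n : ℤ) r • g l else 0 := by
      conv_lhs => rw [hr, Finset.sum_smul, map_sum]
      exact Finset.sum_congr rfl fun n _ => hpiece n
    have hR : degreeProj 𝒜 (d - deg l) r • g l = ∑ n ∈ Finset.range N,
        if d = n + deg l then degreeProj 𝒜 (n : ℤ) r • g l else 0 := by
      conv_lhs => rw [hr, map_sum, Finset.sum_smul]
      refine Finset.sum_congr rfl fun n _ => ?_
      rw [degreeProj_of_mem 𝒜 _ _ _ (degreeProj_mem 𝒜 (n : ℤ) r)]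
      by_cases h : d = n + deg l
      · rw [if_pos h, if_pos (by omega)]
      · rw [if_neg h, if_neg (by omega), zero_smul]
    rw [hL, hR]
  have hproj : ∀ (d : ℤ) (x : Fin b → R),
      π d (Fintype.linearCombination R g x) =
        Fintype.linearCombination R g (freeProj 𝒜 deg d x) := by
    intro d x
    simp only [Fintype.linearCombination_apply, map_sum, hterm]
    rfl
  have hker : ∀ (d : ℤ) (x : Fin b → R), x ∈ LinearMap.ker (Fintype.linearCombination R g) →
      freeProj 𝒜 deg d x ∈ LinearMap.ker (Fintype.linearCombination R g) := by
    intro d x hx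
    rw [LinearMap.mem_ker] at hx ⊢
    rw [← hproj, hx, map_zero]
  refine ⟨b, deg, Fintype.linearCombination R g,
    by rw [Fintype.range_linearCombination, hg], ?_, ?_, ?_⟩
  · intro x hx l
    by_contra hl
    have hu : IsUnit (freeProj 𝒜 deg (deg l) x l) := by
      have h0 : freeProj 𝒜 deg (deg l) x l = GradedRing.proj 𝒜 0 (x l) := by
        change degreeProj 𝒜 (deg l - deg l) (x l) = _
        rw [sub_self]
        rfl
      have hne : GradedRing.proj 𝒜 0 (x l) ≠ 0 := by
        rwa [HomogeneousIdeal.mem_iff, HomogeneousIdeal.mem_irrelevant_iff] at hl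
      have hmem : GradedRing.proj 𝒜 0 (x l) ∈ 𝒜 0 := SetLike.coe_mem _
      rw [IsStandardGraded.degree_zero (𝒜 := 𝒜), Submodule.mem_one] at hmem
      obtain ⟨c, hc⟩ := hmem
      rw [h0, ← hc]
      refine (IsUnit.mk0 c ?_).map (algebraMap k R)
      rintro rfl
      exact hne (by rw [← hc, map_zero])
    rcases b with _ | b
    · exact l.elim0
    · refine hmin b (Nat.lt_succ_self b) ⟨g ∘ l.succAbove, fun j => ⟨_, hdeg _⟩, ?_⟩
      rw [exists_smaller_of_isUnit g _ l hu
        (by simpa [Fintype.linearCombination_apply] using hker (deg l) x hx), hg]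
  · intro j
    rw [Fintype.linearCombination_apply_single, one_smul]
    exact hdeg j
  · apply le_antisymm
    · rw [Submodule.span_le]
      exact fun x hx => hx.1
    · intro x hx
      choose N hN using fun l => sum_degreeProj 𝒜 (x l)
      obtain ⟨B, hB⟩ : ∃ B : ℕ, ∀ l, N l ≤ B ∧ (deg l).natAbs ≤ B := by
        refine ⟨∑ l, (N l + (deg l).natAbs), fun l => ?_⟩
        have := Finset.single_le_sum (f := fun l => N l + (deg l).natAbs)
          (fun _ _ => Nat.zero_le _) (Finset.mem_univ l)
        have h2 : N l + (deg l).natAbs ≤ ∑ l, (N l + (deg l).natAbs) := this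
        omega
      have hsum : x = ∑ d ∈ Finset.Ico (-(B : ℤ)) (2 * B), freeProj 𝒜 deg d x := by
        ext l
        rw [Finset.sum_apply]
        have hd := hB l
        change x l = ∑ d ∈ Finset.Ico (-(B : ℤ)) (2 * B), degreeProj 𝒜 (d - deg l) (x l)
        have h1 := hN l ((2 * B - deg l).toNat) (by omega)
        conv_lhs => rw [h1]
        refine Finset.sum_bij_ne_zero (fun n _ _ => (n : ℤ) + deg l) ?_ ?_ ?_ ?_
        · intro n hn _
          simp only [Finset.mem_range, Finset.mem_Ico] at hn ⊢
          omega
        · intro a _ _ c _ _ h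
          omega
        · intro d hd' hne
          have hnn : 0 ≤ d - deg l := by
            by_contra hneg
            obtain ⟨m, hm⟩ := Int.eq_negSucc_of_lt_zero (not_le.mp hneg)
            rw [hm] at hne
            exact hne rfl
          refine ⟨(d - deg l).toNat, ?_, ?_, ?_⟩
          · simp only [Finset.mem_range, Finset.mem_Ico] at hd' ⊢
            omega
          · rwa [Int.toNat_of_nonneg hnn]
          · rw [Int.toNat_of_nonneg hnn]
            ring
        · intro n _ _
          rw [add_sub_cancel_right]
      rw [hsum]
      refine Submodule.sum_mem _ fun d _ => Submodule.subset_span ⟨hker d x hx, d, fun l => ?_⟩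
      exact degreeProj_mem 𝒜 _ _

lemma freePart_smul_mem {b : ℕ} (deg : Fin b → ℤ) (n : ℕ) (d : ℤ) (a : R) (m : Fin b → R)
    (ha : a ∈ 𝒜 n) (hm : m ∈ freePart 𝒜 deg d) : a • m ∈ freePart 𝒜 deg (n + d) := by
  intro l
  have h := hm l
  rw [add_sub_assoc]
  rcases h' : d - deg l with e | e
  · rw [h'] at h
    exact SetLike.GradedMul.mul_mem (A := 𝒜) ha h
  · rw [h'] at h
    have h0 : m l = 0 := h
    simp [h0]

theorem IsStandardGraded.isNoetherianRing [h : IsStandardGraded 𝒜] : IsNoetherianRing R := by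
  have hf := h.finite_degree_one
  obtain ⟨t, ht⟩ := (Module.Finite.iff_fg.mp hf)
  have : Algebra.FiniteType k R := ⟨⟨t, by
    rw [← h.adjoin_degree_one, ← ht, Algebra.adjoin_span]⟩⟩
  exact Algebra.FiniteType.isNoetherianRing k R

theorem nonempty_gradedMinimalFreeResolution [IsStandardGraded 𝒜] {M : Type v}
    [AddCommGroup M] [Module R M] [Module.Finite R M] (ℳ : ℤ → AddSubgroup M)
    [hℳ : IsGradedModule 𝒜 ℳ] : Nonempty (GradedMinimalFreeResolution 𝒜 ℳ) := by
  classical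
  have := IsStandardGraded.isNoetherianRing 𝒜
  let _ : DirectSum.Decomposition ℳ := hℳ.isInternal.chooseDecomposition
  let π : ℤ → M →+ M := fun d =>
    { toFun := fun m => (DirectSum.decompose ℳ m d : M)
      map_zero' := by simp
      map_add' := fun x y => by simp }
  have hπ : ∀ d e m, m ∈ ℳ e → π d m = if d = e then m else 0 := by
    intro d e m hm
    change (DirectSum.decompose ℳ m d : M) = _
    split_ifs with h
    · subst h
      exact DirectSum.decompose_of_mem_same ℳ hm
    · exact DirectSum.decompose_of_mem_ne ℳ hm (Ne.symm h)
  have htop : Submodule.span R {m | m ∈ (⊤ : Submodule R M) ∧ ∃ d, m ∈ ℳ d} = ⊤ := by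
    rw [eq_top_iff]
    intro m _
    rw [← DirectSum.sum_support_decompose ℳ m]
    exact Submodule.sum_mem _ fun d _ =>
      Submodule.subset_span ⟨trivial, d, SetLike.coe_mem _⟩
  obtain ⟨b, deg, f, hr, hm, hh, hk⟩ :=
    exists_graded_cover 𝒜 ℳ π hπ hℳ.smul_mem ⊤ Module.Finite.fg_top htop
  obtain ⟨F, dg, h₀, hd0, haug, hhom⟩ := exists_resolution_of_step (gradedMaximalIdeal 𝒜) (M := M)
    (fun b deg K => Submodule.span R {x | x ∈ K ∧ ∃ d, x ∈ freePart 𝒜 deg d} = K)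
    (fun b b' deg' deg f => ∀ j, f (Pi.single j 1) ∈ freePart 𝒜 deg (deg' j))
    (fun b deg K hK => exists_graded_cover 𝒜 (freePart 𝒜 deg) (freeProj 𝒜 deg)
      (fun d e m hm => by
        ext l
        change degreeProj 𝒜 (d - deg l) (m l) = _
        rw [degreeProj_of_mem 𝒜 _ _ _ (hm l)]
        by_cases h : d = e
        · simp [h]
        · rw [if_neg h, if_neg (by omega)]
          rfl)
      (freePart_smul_mem 𝒜 deg) K (IsNoetherian.noetherian K) hK)
    b deg f (LinearMap.range_eq_top.mp hr) hm hk
  refine ⟨{ F with deg := dg, d_homogeneous := fun i j l => hhom i j l, aug_homogeneous := ?_ }⟩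
  intro j
  rw [haug, hd0]
  have : (fun i => (Pi.single j 1 : Fin (F.rank 0) → R) (Fin.cast h₀.symm i)) =
      Pi.single (Fin.cast h₀ j) 1 := by
    ext i
    simp only [Pi.single_apply, Fin.ext_iff, Fin.val_cast]
  rw [this]
  exact hh _

end GradedExistence

/-- The linearity defect of a finitely generated graded module over a standard graded algebra,
computed from the minimal graded free resolution of `M`. -/
noncomputable def gradedLind {k : Type w} {R : Type u} [Field k] [CommRing R] [Algebra k R]
    (𝒜 : ℕ → Submodule k R) [GradedAlgebra 𝒜] [IsStandardGraded 𝒜] {M : Type v}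
    [AddCommGroup M] [Module R M] [Module.Finite R M] (ℳ : ℤ → AddSubgroup M)
    [IsGradedModule 𝒜 ℳ] : ℕ∞ :=
  (Classical.choice (nonempty_gradedMinimalFreeResolution 𝒜 ℳ)).linDefect

/-- Graded Koszul modules over a standard graded algebra. -/
def IsGradedKoszulModule {k : Type w} {R : Type u} [Field k] [CommRing R] [Algebra k R]
    (𝒜 : ℕ → Submodule k R) [GradedAlgebra 𝒜] [IsStandardGraded 𝒜] {M : Type v}
    [AddCommGroup M] [Module R M] [Module.Finite R M] (ℳ : ℤ → AddSubgroup M)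
    [IsGradedModule 𝒜 ℳ] : Prop :=
  gradedLind 𝒜 ℳ = 0

/-! Linear maps and powers of an ideal. -/

section Powers

variable {R : Type u} [CommRing R] (𝔪 : Ideal R) {A B : Type*} [AddCommGroup A] [Module R A]
  [AddCommGroup B] [Module R B]

/-! Let F, G, L be minimal resolutions of M', P', N'. The horseshoe construction glues F and L into
a resolution of P' with terms F_i ⊕ L_i and differential (u, v) ↦ (d u + τ v, d v). Koszulness of M'
together with M' ∩ 𝔪P' = 𝔪M' forces the twist τ to take values in 𝔪F (`range_twist_le`), so the
glued resolution is minimal. The linearity defect does not depend on the minimal resolution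
(`linExactAt_iff`), so the glued one computes that of P'.

The twist then respects the filtrations, and 0 → lin F → lin G → lin L → 0 is exact, with connecting
map induced by τ. Since H_i(lin F) = 0 for i ≥ 1, the long exact sequence gives H_i(lin G) ≅ H_i(lin
L) for i ≥ 2 and an injection H_1(lin G) → H_1(lin L). This yields both inequalities: only H_1(lin
L) can be non-zero without H_1(lin G) being so, through the connecting map to H_0(lin F). The proof
does these chases on elements instead of building the sequence.

For the last claim, H_1(lin L) = 0 makes d_0 strict: a boundary in 𝔪^(n+1)L_0 comes from 𝔪^n L_1.
This gives the equalities M' ∩ 𝔪^s P' = 𝔪^s M' (`range_inf_pow_smul_top`); conversely, these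
equalities make the connecting map to H_0(lin F) vanish (`linExactAt_zero_right`). All of this works
for an arbitrary ideal 𝔪, so the local and the graded case are two instances of one statement. -/

lemma LinearMap.map_mem_pow_smul_top (f : A →ₗ[R] B) (s : ℕ) {x : A}
    (hx : x ∈ 𝔪 ^ s • (⊤ : Submodule R A)) : f x ∈ 𝔪 ^ s • (⊤ : Submodule R B) := by
  have h : (𝔪 ^ s • (⊤ : Submodule R A)).map f ≤ 𝔪 ^ s • ⊤ := by
    rw [Submodule.map_smul'']
    exact Submodule.smul_mono le_rfl le_top
  exact h (Submodule.mem_map_of_mem hx)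

lemma LinearMap.map_mem_pow_succ_smul_top (f : A →ₗ[R] B)
    (hf : LinearMap.range f ≤ 𝔪 • (⊤ : Submodule R B)) (s : ℕ) {x : A}
    (hx : x ∈ 𝔪 ^ s • (⊤ : Submodule R A)) : f x ∈ 𝔪 ^ (s + 1) • (⊤ : Submodule R B) := by
  have h : (𝔪 ^ s • (⊤ : Submodule R A)).map f ≤ 𝔪 ^ (s + 1) • ⊤ := by
    rw [Submodule.map_smul'', Submodule.map_top, pow_succ, Submodule.mul_smul]
    exact Submodule.smul_mono le_rfl hf
  exact h (Submodule.mem_map_of_mem hx)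

lemma LinearMap.exists_mem_pow_smul_top (f : A →ₗ[R] B) (hf : Function.Surjective f) (s : ℕ)
    {y : B} (hy : y ∈ 𝔪 ^ s • (⊤ : Submodule R B)) :
    ∃ x ∈ 𝔪 ^ s • (⊤ : Submodule R A), f x = y := by
  rwa [← LinearMap.range_eq_top.mpr hf, ← Submodule.map_top, ← Submodule.map_smul''] at hy

lemma Submodule.prod_mk_mem_smul_top {I : Ideal R} {x : A × B} :
    x ∈ I • (⊤ : Submodule R (A × B)) ↔
      x.1 ∈ I • (⊤ : Submodule R A) ∧ x.2 ∈ I • (⊤ : Submodule R B) := by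
  constructor
  · intro hx
    have h1 := LinearMap.map_mem_pow_smul_top I (LinearMap.fst R A B) 1 (by simpa using hx)
    have h2 := LinearMap.map_mem_pow_smul_top I (LinearMap.snd R A B) 1 (by simpa using hx)
    exact ⟨by simpa using h1, by simpa using h2⟩
  · rintro ⟨h1, h2⟩
    have h1 := LinearMap.map_mem_pow_smul_top I (LinearMap.inl R A B) 1 (by simpa using h1)
    have h2 := LinearMap.map_mem_pow_smul_top I (LinearMap.inr R A B) 1 (by simpa using h2)
    simpa using Submodule.add_mem _ h1 h2

end Powers

/-! Constructing sequences of maps out of free modules. -/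

lemma LinearMap.exists_comp_eq_of_range_le {R : Type u} [CommRing R] {A B C : Type*}
    [AddCommGroup A] [Module R A] [Module.Projective R A] [AddCommGroup B] [Module R B]
    [AddCommGroup C] [Module R C] (f : A →ₗ[R] C) (g : B →ₗ[R] C)
    (h : LinearMap.range f ≤ LinearMap.range g) : ∃ l : A →ₗ[R] B, g ∘ₗ l = f := by
  obtain ⟨l, hl⟩ := Module.projective_lifting_property g.rangeRestrict
    (f.codRestrict (LinearMap.range g) fun x => h ⟨x, rfl⟩) g.surjective_rangeRestrict
  refine ⟨l, LinearMap.ext fun x => ?_⟩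
  simpa using congrArg Subtype.val (LinearMap.congr_fun hl x)

/-- Dependent choice with an invariant `P` that makes the next step possible. In each use, `P` says
that the map to be lifted next lands in the image of a differential. -/
lemma exists_seq_of_step {T : ℕ → Type*} (P : ∀ i, T i → Prop) (rel : ∀ i, T i → T (i + 1) → Prop)
    (t₀ : T 0) (h₀ : P 0 t₀) (step : ∀ i t, P i t → ∃ t', P (i + 1) t' ∧ rel i t t') :
    ∃ s : ∀ i, T i, s 0 = t₀ ∧ ∀ i, rel i (s i) (s (i + 1)) := by
  choose nxt h1 h2 using step
  let s : ∀ i, {t : T i // P i t} := fun i =>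
    Nat.rec ⟨t₀, h₀⟩ (fun i t => ⟨nxt i t.1 t.2, h1 i t.1 t.2⟩) i
  exact ⟨fun i => (s i).1, rfl, fun i => h2 i (s i).1 (s i).2⟩

/-! ### Exactness of the linear part, on elements. -/

namespace MinimalFreeResolution

variable {R : Type u} [CommRing R] {𝔪 : Ideal R} {M : Type v} [AddCommGroup M] [Module R M]

lemma mem_filt (F : MinimalFreeResolution 𝔪 M) {n i : ℕ} {x : Fin (F.rank i) → R} :
    x ∈ F.filt n i ↔ x ∈ 𝔪 ^ (n - i) • (⊤ : Submodule R (Fin (F.rank i) → R)) := Iff.rfl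

lemma filt_succ_le (F : MinimalFreeResolution 𝔪 M) (n i : ℕ) : F.filt (n + 1) i ≤ F.filt n i :=
  Submodule.smul_mono_left (Ideal.pow_le_pow_right (by omega))

lemma mem_filt_of_le (F : MinimalFreeResolution 𝔪 M) {n i : ℕ} (h : n ≤ i)
    (x : Fin (F.rank i) → R) : x ∈ F.filt n i := by
  rw [mem_filt, Nat.sub_eq_zero_of_le h, pow_zero, Ideal.one_eq_top, Submodule.top_smul]
  trivial

lemma mem_filt_succ_succ (F : MinimalFreeResolution 𝔪 M) {n i : ℕ}
    {x : Fin (F.rank (i + 1)) → R} :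
    x ∈ F.filt (n + 1) (i + 1) ↔
      x ∈ 𝔪 ^ (n - i) • (⊤ : Submodule R (Fin (F.rank (i + 1)) → R)) := by
  rw [mem_filt, Nat.add_sub_add_right]

lemma d_d (F : MinimalFreeResolution 𝔪 M) (i : ℕ) (x : Fin (F.rank (i + 2)) → R) :
    F.d i (F.d (i + 1) x) = 0 := by
  have h : F.d (i + 1) x ∈ LinearMap.range (F.d (i + 1)) := ⟨x, rfl⟩
  rwa [F.exact_succ] at h

lemma aug_d (F : MinimalFreeResolution 𝔪 M) (x : Fin (F.rank 1) → R) : F.aug (F.d 0 x) = 0 := by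
  have h : F.d 0 x ∈ LinearMap.range (F.d 0) := ⟨x, rfl⟩
  rwa [F.exact_zero] at h

lemma exists_d_eq (F : MinimalFreeResolution 𝔪 M) (i : ℕ) {x : Fin (F.rank (i + 1)) → R}
    (hx : F.d i x = 0) : ∃ y, F.d (i + 1) y = x := by
  have h : x ∈ LinearMap.ker (F.d i) := hx
  rwa [← F.exact_succ] at h

lemma exists_d_zero_eq (F : MinimalFreeResolution 𝔪 M) {x : Fin (F.rank 0) → R}
    (hx : F.aug x = 0) : ∃ y, F.d 0 y = x := by
  have h : x ∈ LinearMap.ker F.aug := hx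
  rwa [← F.exact_zero] at h

/-- Exactness of the linear part of `F` in homological degree `i + 1`, in terms of elements. -/
def LinExactAt (F : MinimalFreeResolution 𝔪 M) (i : ℕ) : Prop :=
  ∀ n, ∀ x ∈ F.filt n (i + 1), F.d i x ∈ F.filt (n + 1) i →
    ∃ y ∈ F.filt n (i + 2), x - F.d (i + 1) y ∈ F.filt (n + 1) (i + 1)

lemma linExactAt_iff_exact_grD (F : MinimalFreeResolution 𝔪 M) (i : ℕ) :
    F.LinExactAt i ↔ ∀ n, ∀ x, F.grD n i x = 0 → ∃ y, F.grD n (i + 1) y = x := by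
  refine forall_congr' fun n => ⟨fun h x => ?_, fun h x hx hdx => ?_⟩
  · obtain ⟨x, rfl⟩ := Submodule.Quotient.mk_surjective _ x
    intro hx
    obtain ⟨y, hy, hxy⟩ := h x.1 x.2 (show ((F.d i).restrict (F.d_mem_filt n i) x) ∈
      (F.filt (n + 1) i).submoduleOf (F.filt n i) from (Submodule.Quotient.mk_eq_zero _).mp hx)
    refine ⟨Submodule.Quotient.mk ⟨y, hy⟩, ((Submodule.Quotient.eq _).mpr ?_).symm⟩
    exact hxy
  · obtain ⟨y, hy⟩ := h (Submodule.Quotient.mk ⟨x, hx⟩)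
      ((Submodule.Quotient.mk_eq_zero ((F.filt (n + 1) i).submoduleOf (F.filt n i))).mpr hdx)
    obtain ⟨y, rfl⟩ := Submodule.Quotient.mk_surjective _ y
    exact ⟨y.1, y.2, (Submodule.Quotient.eq ((F.filt (n + 1) (i + 1)).submoduleOf
      (F.filt n (i + 1)))).mp hy.symm⟩

/-- The differential of the linear part acts summand by summand, so a direct sum of complexes is
exact exactly when each summand is. -/
lemma isZero_homology_linPart_iff (F : MinimalFreeResolution 𝔪 M) (i : ℕ) :
    Limits.IsZero (F.linPart.homology (i + 1)) ↔ F.LinExactAt i := by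
  classical
  rw [← HomologicalComplex.exactAt_iff_isZero_homology,
    HomologicalComplex.exactAt_iff' _ (i + 2) (i + 1) i (by simp) (by simp),
    ShortComplex.moduleCat_exact_iff, linExactAt_iff_exact_grD]
  have hd : ∀ j, F.linPart.d (j + 1) j =
      ModuleCat.ofHom (DirectSum.lmap fun n => F.grD n j) := fun j => by
    unfold linPart
    simp
  change (∀ x : DirectSum ℕ fun n => F.Gr n (i + 1), (F.linPart.d (i + 1) i).hom x = 0 →
    ∃ y : DirectSum ℕ fun n => F.Gr n (i + 2), (F.linPart.d (i + 2) (i + 1)).hom y = x) ↔ _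
  have hd' : ∀ j (x : DirectSum ℕ fun n => F.Gr n (j + 1)), (F.linPart.d (j + 1) j).hom x =
      DirectSum.lmap (fun n => F.grD n j) x := fun j x => by rw [hd]; rfl
  simp only [hd']
  constructor
  · intro h n x hx
    obtain ⟨y, hy⟩ := h (DirectSum.lof R ℕ (fun n => F.Gr n (i + 1)) n x) (by
      rw [DirectSum.lmap_lof, hx]; exact map_zero _)
    refine ⟨y n, ?_⟩
    have := congrArg (fun z : DirectSum ℕ fun n => F.Gr n (i + 1) => z n) hy
    simpa [DirectSum.lof_eq_of] using this
  · intro h x hx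
    have hx' : ∀ n, F.grD n i (x n) = 0 := fun n =>
      congrArg (fun z : DirectSum ℕ fun n => F.Gr n i => z n) hx
    choose y hy using fun n => h n (x n) (hx' n)
    -- A preimage is chosen for every n; restricting to the support of `x` makes the sum finite.
    refine ⟨∑ n ∈ DFinsupp.support x, DirectSum.lof R ℕ (fun n => F.Gr n (i + 2)) n (y n), ?_⟩
    rw [map_sum]
    simp only [DirectSum.lmap_lof, hy]
    exact DirectSum.sum_support_of x

/-! Independence of the resolution. -/

lemma exists_comparison (F F' : MinimalFreeResolution 𝔪 M) :
    ∃ a : ∀ i, (Fin (F.rank i) → R) →ₗ[R] (Fin (F'.rank i) → R),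
      (∀ x, F'.aug (a 0 x) = F.aug x) ∧ ∀ i x, F'.d i (a (i + 1) x) = a i (F.d i x) := by
  obtain ⟨a₀, ha₀⟩ := LinearMap.exists_comp_eq_of_range_le F.aug F'.aug
    (by rw [LinearMap.range_eq_top.mpr F'.aug_surjective]; exact le_top)
  obtain ⟨a, ha, hs⟩ := exists_seq_of_step
    (T := fun i => (Fin (F.rank i) → R) →ₗ[R] (Fin (F'.rank i) → R))
    (fun i a => LinearMap.range (a ∘ₗ F.d i) ≤ LinearMap.range (F'.d i))
    (fun i a a' => F'.d i ∘ₗ a' = a ∘ₗ F.d i) a₀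
    (by
      rintro _ ⟨x, rfl⟩
      refine F'.exists_d_zero_eq ?_
      rw [LinearMap.comp_apply, ← LinearMap.comp_apply, ha₀, F.aug_d])
    (fun i a hi => by
      obtain ⟨a', ha'⟩ := LinearMap.exists_comp_eq_of_range_le _ _ hi
      refine ⟨a', ?_, ha'⟩
      rintro _ ⟨x, rfl⟩
      refine F'.exists_d_eq i ?_
      rw [LinearMap.comp_apply, ← LinearMap.comp_apply, ha', LinearMap.comp_apply, F.d_d,
        map_zero])
  refine ⟨a, fun x => ?_, fun i x => LinearMap.congr_fun (hs i) x⟩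
  rw [ha, ← ha₀]
  rfl

/-- Only positive degrees are recorded, because `LinExactAt` never concerns homological degree 0;
there `h 0` is simply a lift of `c 0` through `d 0`. -/
lemma exists_homotopy (F : MinimalFreeResolution 𝔪 M)
    (c : ∀ i, (Fin (F.rank i) → R) →ₗ[R] (Fin (F.rank i) → R))
    (hc₀ : ∀ x, F.aug (c 0 x) = 0) (hc : ∀ i x, F.d i (c (i + 1) x) = c i (F.d i x)) :
    ∃ h : ∀ i, (Fin (F.rank i) → R) →ₗ[R] (Fin (F.rank (i + 1)) → R),
      ∀ i x, F.d (i + 1) (h (i + 1) x) + h i (F.d i x) = c (i + 1) x := by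
  obtain ⟨h₀, hh₀⟩ := LinearMap.exists_comp_eq_of_range_le (c 0) (F.d 0)
    (by
      rintro _ ⟨x, rfl⟩
      exact F.exists_d_zero_eq (hc₀ x))
  obtain ⟨h, -, hs⟩ := exists_seq_of_step
    (T := fun i => (Fin (F.rank i) → R) →ₗ[R] (Fin (F.rank (i + 1)) → R))
    (fun i h => LinearMap.range (c (i + 1) - h ∘ₗ F.d i) ≤ LinearMap.range (F.d (i + 1)))
    (fun i h h' => F.d (i + 1) ∘ₗ h' = c (i + 1) - h ∘ₗ F.d i) h₀
    (by
      rintro _ ⟨x, rfl⟩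
      refine F.exists_d_eq 0 ?_
      have := LinearMap.congr_fun hh₀ (F.d 0 x)
      simp only [LinearMap.comp_apply] at this
      simp only [LinearMap.sub_apply, LinearMap.comp_apply, map_sub, hc, this, sub_self])
    (fun i h hi => by
      obtain ⟨h', hh'⟩ := LinearMap.exists_comp_eq_of_range_le _ _ hi
      refine ⟨h', ?_, hh'⟩
      rintro _ ⟨x, rfl⟩
      refine F.exists_d_eq (i + 1) ?_
      have := LinearMap.congr_fun hh' (F.d (i + 1) x)
      simp only [LinearMap.comp_apply, LinearMap.sub_apply, F.d_d, map_zero, sub_zero] at this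
      simp only [LinearMap.sub_apply, LinearMap.comp_apply, map_sub, hc, this, sub_self])
  refine ⟨h, fun i x => ?_⟩
  have := LinearMap.congr_fun (hs i) x
  simp only [LinearMap.comp_apply, LinearMap.sub_apply] at this
  rw [this, sub_add_cancel]

/-- Linear maps preserve multiples of powers of 𝔪, so comparison maps are automatically filtered.
The homotopy from the identity to `b ∘ a` sends 𝒢ⁿ into 𝒢ⁿ⁺¹, hence `b ∘ a` induces the identity on
the linear part in positive degrees and exactness transfers. Homotopy equivalence suffices, without
an isomorphism of resolutions, so 𝔪 may be any ideal. -/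
lemma LinExactAt.of_resolution {F F' : MinimalFreeResolution 𝔪 M} {i : ℕ}
    (h' : F'.LinExactAt i) : F.LinExactAt i := by
  obtain ⟨a, ha₀, ha⟩ := exists_comparison F F'
  obtain ⟨b, hb₀, hb⟩ := exists_comparison F' F
  obtain ⟨h, hh⟩ := F.exists_homotopy (fun i => LinearMap.id - b i ∘ₗ a i)
    (fun x => by simp [ha₀, hb₀]) (fun i x => by simp [ha, hb])
  intro n x hx hdx
  obtain ⟨y, hy, hxy⟩ := h' n (a (i + 1) x) (LinearMap.map_mem_pow_smul_top 𝔪 _ _ hx)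
    (by rw [ha]; exact LinearMap.map_mem_pow_smul_top 𝔪 _ _ hdx)
  refine ⟨b (i + 2) y, LinearMap.map_mem_pow_smul_top 𝔪 _ _ hy, ?_⟩
  have h1 : b (i + 1) (a (i + 1) x) - F.d (i + 1) (b (i + 2) y) ∈ F.filt (n + 1) (i + 1) := by
    rw [hb, ← map_sub]
    exact LinearMap.map_mem_pow_smul_top 𝔪 _ _ hxy
  -- The homotopy raises the homological degree and keeps the power of 𝔪, which gains one step of
  -- the filtration.
  have h2 : x - b (i + 1) (a (i + 1) x) ∈ F.filt (n + 1) (i + 1) := by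
    have := hh i x
    simp only [LinearMap.sub_apply, LinearMap.comp_apply, LinearMap.id_apply] at this
    rw [← this]
    refine Submodule.add_mem _ (F.d_mem_filt (n + 1) (i + 1) _ ?_) ?_
    · rw [mem_filt_succ_succ]
      exact LinearMap.map_mem_pow_smul_top 𝔪 _ _ hx
    · rw [mem_filt_succ_succ]
      refine LinearMap.map_mem_pow_smul_top 𝔪 _ _ ?_
      exact F.filt_succ_le _ _ hdx
  simpa using Submodule.add_mem _ h2 h1

lemma linExactAt_iff (F F' : MinimalFreeResolution 𝔪 M) (i : ℕ) :
    F.LinExactAt i ↔ F'.LinExactAt i :=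
  ⟨LinExactAt.of_resolution, LinExactAt.of_resolution⟩

/-- Strictness of `d 0`: as long as `d 0 y` lies deeper than `y` accounts for, `y` is a cycle of the
linear part, and subtracting a boundary moves it one power of 𝔪 deeper. Finitely many corrections
reach 𝔪^n, so no completeness is needed. -/
lemma exists_eq_add_d_of_linExactAt_zero {F : MinimalFreeResolution 𝔪 M} (hF : F.LinExactAt 0)
    (n : ℕ) (y : Fin (F.rank 1) → R) (hy : F.d 0 y ∈ 𝔪 ^ (n + 1) • (⊤ : Submodule R _)) :
    ∃ y' ∈ 𝔪 ^ n • (⊤ : Submodule R (Fin (F.rank 1) → R)), ∃ c, y = y' + F.d 1 c := by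
  suffices ∀ j ≤ n, ∃ y' ∈ 𝔪 ^ j • (⊤ : Submodule R (Fin (F.rank 1) → R)),
      ∃ c, y = y' + F.d 1 c from this n le_rfl
  intro j
  induction j with
  | zero => exact fun _ => ⟨y, by rw [pow_zero, Ideal.one_eq_top, Submodule.top_smul]; trivial,
      0, by simp⟩
  | succ j ih =>
    intro hj
    obtain ⟨y', hy', c, rfl⟩ := ih (by omega)
    -- In homological degree 1, 𝔪^j is the filtration step j + 1; and j + 1 ≤ n puts `d 0 y'` in
    -- 𝔪^(j+2).
    obtain ⟨e, -, he⟩ := hF (j + 1) y' hy' (by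
      rw [map_add, F.d_d, add_zero] at hy
      exact Submodule.smul_mono_left (Ideal.pow_le_pow_right (by omega)) hy)
    exact ⟨_, he, c + e, by rw [map_add]; abel⟩

/-! ### The linearity defect in terms of exactness. -/

lemma linDefect_le_iff (F : MinimalFreeResolution 𝔪 M) (e : ℕ∞) :
    F.linDefect ≤ e ↔ ∀ i : ℕ, ¬ F.LinExactAt i → ((i + 1 : ℕ) : ℕ∞) ≤ e := by
  unfold linDefect
  rw [sSup_le_iff]
  constructor
  · intro h i hi
    exact h _ ⟨i + 1, rfl, fun h0 => hi ((F.isZero_homology_linPart_iff i).mp h0)⟩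
  · rintro h _ ⟨i, rfl, hi⟩
    rcases i with _ | i
    -- Homology in degree 0 contributes only the value 0 to the supremum.
    · simp
    · exact h i fun h0 => hi ((F.isZero_homology_linPart_iff i).mpr h0)

lemma linDefect_eq_zero_iff (F : MinimalFreeResolution 𝔪 M) :
    F.linDefect = 0 ↔ ∀ i, F.LinExactAt i := by
  rw [← nonpos_iff_eq_zero, linDefect_le_iff]
  refine forall_congr' fun i => ?_
  simp

end MinimalFreeResolution

/-! The horseshoe construction. -/

/-- The data gluing resolutions `F` of `M` and `L` of `N` to a resolution of the middle term `P` of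
an exact sequence `M → P → N`: the augmentation is `φ ε_F + aug` and the differential is
`(u, v) ↦ (d u + twist v, d v)`. -/
structure HorseshoeData {R : Type u} [CommRing R] {𝔪 : Ideal R} {M P N : Type v}
    [AddCommGroup M] [Module R M] [AddCommGroup P] [Module R P] [AddCommGroup N] [Module R N]
    (F : MinimalFreeResolution 𝔪 M) (L : MinimalFreeResolution 𝔪 N)
    (φ : M →ₗ[R] P) (ψ : P →ₗ[R] N) where
  aug : (Fin (L.rank 0) → R) →ₗ[R] P
  twist : ∀ i, (Fin (L.rank (i + 1)) → R) →ₗ[R] (Fin (F.rank i) → R)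
  map_aug : ∀ x, ψ (aug x) = L.aug x
  aug_twist : ∀ x, φ (F.aug (twist 0 x)) = -aug (L.d 0 x)
  d_twist : ∀ i x, F.d i (twist (i + 1) x) = -twist i (L.d (i + 1) x)

namespace HorseshoeData

variable {R : Type u} [CommRing R] {𝔪 : Ideal R} {M P N : Type v}
  [AddCommGroup M] [Module R M] [AddCommGroup P] [Module R P] [AddCommGroup N] [Module R N]
  {F : MinimalFreeResolution 𝔪 M} {L : MinimalFreeResolution 𝔪 N}
  {φ : M →ₗ[R] P} {ψ : P →ₗ[R] N}

/-- Freeness of the L_i supplies each piece. The augmentation of L lifts to σ through ψ; then σ d_0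
lands in ker ψ = im φ, which gives the first twist; and each composite of a twist with the
differential of L is a cycle of F, hence lifts to the next twist. Injectivity of φ is what makes the
first of these composites a cycle. -/
theorem nonempty (F : MinimalFreeResolution 𝔪 M) (L : MinimalFreeResolution 𝔪 N)
    (hφ : Function.Injective φ) (hφψ : Function.Exact φ ψ) (hψ : Function.Surjective ψ) :
    Nonempty (HorseshoeData F L φ ψ) := by
  obtain ⟨σ, hσ⟩ := LinearMap.exists_comp_eq_of_range_le L.aug ψ
    (by rw [LinearMap.range_eq_top.mpr hψ]; exact le_top)
  obtain ⟨θ₀, hθ₀⟩ := LinearMap.exists_comp_eq_of_range_le (-(σ ∘ₗ L.d 0)) (φ ∘ₗ F.aug) (by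
    rintro _ ⟨x, rfl⟩
    obtain ⟨m, hm⟩ := (hφψ (-σ (L.d 0 x))).mp (by
      rw [map_neg, ← LinearMap.comp_apply, hσ, L.aug_d, neg_zero])
    obtain ⟨y, rfl⟩ := F.aug_surjective m
    exact ⟨y, hm⟩)
  obtain ⟨θ, hθ, hs⟩ := exists_seq_of_step
    (T := fun i => (Fin (L.rank (i + 1)) → R) →ₗ[R] (Fin (F.rank i) → R))
    (fun i t => LinearMap.range (-(t ∘ₗ L.d (i + 1))) ≤ LinearMap.range (F.d i))
    (fun i t t' => F.d i ∘ₗ t' = -(t ∘ₗ L.d (i + 1))) θ₀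
    (by
      rintro _ ⟨x, rfl⟩
      refine F.exists_d_zero_eq (hφ ?_)
      have := LinearMap.congr_fun hθ₀ (L.d 1 x)
      simp only [LinearMap.comp_apply, LinearMap.neg_apply, L.d_d, map_zero, neg_zero] at this
      simp only [LinearMap.comp_apply, LinearMap.neg_apply, map_neg, this, map_zero, neg_zero])
    (fun i t hi => by
      obtain ⟨t', ht'⟩ := LinearMap.exists_comp_eq_of_range_le _ _ hi
      refine ⟨t', ?_, ht'⟩
      rintro _ ⟨x, rfl⟩
      refine F.exists_d_eq i ?_
      have := LinearMap.congr_fun ht' (L.d (i + 2) x)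
      simp only [LinearMap.comp_apply, LinearMap.neg_apply, L.d_d, map_zero, neg_zero] at this
      simp only [LinearMap.comp_apply, LinearMap.neg_apply, map_neg, this, neg_zero])
  subst hθ
  exact ⟨⟨σ, θ, LinearMap.congr_fun hσ, LinearMap.congr_fun hθ₀,
    fun i => LinearMap.congr_fun (hs i)⟩⟩

variable (D : HorseshoeData F L φ ψ)
include D

/-- If `M` is Koszul and `M ∩ 𝔪 P = 𝔪 M`, then gluing preserves minimality. -/
lemma range_twist_le (hφ : Function.Injective φ) (hF : ∀ i, F.LinExactAt i)
    (hM : LinearMap.range φ ⊓ 𝔪 • (⊤ : Submodule R P) = (𝔪 • (⊤ : Submodule R M)).map φ) (i : ℕ) :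
    LinearMap.range (D.twist i) ≤ 𝔪 • (⊤ : Submodule R (Fin (F.rank i) → R)) := by
  induction i with
  | zero =>
    rintro _ ⟨x, rfl⟩
    have h1 : φ (F.aug (D.twist 0 x)) ∈ (𝔪 • (⊤ : Submodule R M)).map φ := by
      rw [← hM]
      refine ⟨⟨_, rfl⟩, ?_⟩
      rw [D.aug_twist]
      have := LinearMap.map_mem_pow_smul_top 𝔪 D.aug 1
        (by rw [pow_one]; exact L.minimal 0 ⟨x, rfl⟩)
      exact Submodule.neg_mem _ (by rwa [pow_one] at this)
    obtain ⟨m, hm, hmx⟩ := h1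
    rw [← pow_one 𝔪] at hm
    obtain ⟨z, hz, rfl⟩ := LinearMap.exists_mem_pow_smul_top 𝔪 F.aug F.aug_surjective 1 hm
    -- The difference is killed by the augmentation, hence is a boundary, hence lies in 𝔪F_0 by
    -- minimality.
    obtain ⟨y, hy⟩ := F.exists_d_zero_eq (x := D.twist 0 x - z) (by
      rw [map_sub, hφ hmx, sub_self])
    rw [← sub_add_cancel (D.twist 0 x) z, ← hy]
    exact Submodule.add_mem _ (F.minimal 0 ⟨y, rfl⟩) (by rwa [pow_one] at hz)
  | succ i ih =>
    rintro _ ⟨x, rfl⟩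
    -- Filtration step i + 1 is all of F_(i+1), and the differential of the twist lies in 𝔪², one
    -- step deeper than expected; so the twist is a boundary modulo 𝔪F_(i+1).
    obtain ⟨y, -, hy⟩ := hF i (i + 1) (D.twist (i + 1) x)
      (F.mem_filt_of_le le_rfl _)
      (by
        rw [D.d_twist, MinimalFreeResolution.mem_filt]
        refine Submodule.neg_mem _ ?_
        have := LinearMap.map_mem_pow_succ_smul_top 𝔪 (D.twist i) ih 1
          (by rw [pow_one]; exact L.minimal (i + 1) ⟨x, rfl⟩)
        rwa [show i + 1 + 1 - i = 1 + 1 by omega])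
    rw [MinimalFreeResolution.mem_filt_succ_succ, show i + 1 - i = 1 by omega, pow_one] at hy
    rw [← sub_add_cancel (D.twist (i + 1) x) (F.d (i + 1) y)]
    exact Submodule.add_mem _ hy (F.minimal (i + 1) ⟨y, rfl⟩)

omit D in
/-- Coordinates on `R ^ (a + b)`. -/
def split (R : Type u) [CommRing R] (a b : ℕ) :
    (Fin (a + b) → R) ≃ₗ[R] (Fin a → R) × (Fin b → R) :=
  (LinearEquiv.funCongrLeft R R finSumFinEquiv).trans
    (LinearEquiv.sumArrowLequivProdArrow (Fin a) (Fin b) R R)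

omit D in
lemma mem_smul_top_iff_split {I : Ideal R} {a b : ℕ} {x : Fin (a + b) → R} :
    x ∈ I • (⊤ : Submodule R (Fin (a + b) → R)) ↔
      (split R a b x).1 ∈ I • (⊤ : Submodule R (Fin a → R)) ∧
      (split R a b x).2 ∈ I • (⊤ : Submodule R (Fin b → R)) := by
  rw [← Submodule.prod_mk_mem_smul_top]
  constructor
  · intro hx
    have := LinearMap.map_mem_pow_smul_top I (split R a b).toLinearMap 1 (by rwa [pow_one])
    rwa [pow_one] at this
  · intro hx
    have := LinearMap.map_mem_pow_smul_top I (split R a b).symm.toLinearMap 1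
      (by rwa [pow_one])
    rwa [pow_one, LinearEquiv.coe_coe, LinearEquiv.symm_apply_apply] at this

/-- The differential of the glued complex, on pairs. -/
def d (i : ℕ) : (Fin (F.rank (i + 1)) → R) × (Fin (L.rank (i + 1)) → R) →ₗ[R]
    (Fin (F.rank i) → R) × (Fin (L.rank i) → R) :=
  ((F.d i).coprod (D.twist i)).prod (L.d i ∘ₗ LinearMap.snd R _ _)

lemma d_apply (i : ℕ) (u : Fin (F.rank (i + 1)) → R) (v : Fin (L.rank (i + 1)) → R) :
    D.d i (u, v) = (F.d i u + D.twist i v, L.d i v) := rfl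

/-- The glued resolution of the middle term. -/
def resolution (hφ : Function.Injective φ) (hφψ : Function.Exact φ ψ)
    (hD : ∀ i, LinearMap.range (D.twist i) ≤ 𝔪 • (⊤ : Submodule R (Fin (F.rank i) → R))) :
    MinimalFreeResolution 𝔪 P where
  rank i := F.rank i + L.rank i
  d i := (split R _ _).symm.toLinearMap ∘ₗ D.d i ∘ₗ (split R _ _).toLinearMap
  aug := ((φ ∘ₗ F.aug).coprod D.aug) ∘ₗ (split R _ _).toLinearMap
  aug_surjective := by
    intro p
    obtain ⟨v, hv⟩ := L.aug_surjective (ψ p)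
    obtain ⟨m, hm⟩ := (hφψ (p - D.aug v)).mp (by rw [map_sub, D.map_aug, hv, sub_self])
    obtain ⟨u, rfl⟩ := F.aug_surjective m
    refine ⟨(split R _ _).symm (u, v), ?_⟩
    simp [hm]
  exact_zero := by
    apply le_antisymm
    · rintro _ ⟨x, rfl⟩
      obtain ⟨⟨u, v⟩, rfl⟩ := (split R _ _).symm.surjective x
      simp [d_apply, F.aug_d, D.aug_twist]
    · intro x hx
      obtain ⟨⟨u, v⟩, rfl⟩ := (split R _ _).symm.surjective x
      have hx : φ (F.aug u) + D.aug v = 0 := by simpa using hx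
      obtain ⟨b, rfl⟩ := L.exists_d_zero_eq (x := v) (by
        have := congrArg ψ hx
        rwa [map_add, hφψ.apply_apply_eq_zero, zero_add, D.map_aug, map_zero] at this)
      obtain ⟨a, ha⟩ := F.exists_d_zero_eq (x := u - D.twist 0 b) (hφ (by
        rw [map_sub, map_sub, D.aug_twist, sub_neg_eq_add, hx, map_zero]))
      exact ⟨(split R _ _).symm (a, b), by simp [d_apply, ha]⟩
  exact_succ i := by
    apply le_antisymm
    · rintro _ ⟨x, rfl⟩
      obtain ⟨⟨u, v⟩, rfl⟩ := (split R _ _).symm.surjective x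
      simp [d_apply, F.d_d, L.d_d, D.d_twist]
    · intro x hx
      obtain ⟨⟨u, v⟩, rfl⟩ := (split R _ _).symm.surjective x
      have hx : F.d i u + D.twist i v = 0 ∧ L.d i v = 0 := by simpa [d_apply] using hx
      obtain ⟨b, rfl⟩ := L.exists_d_eq i hx.2
      obtain ⟨a, ha⟩ := F.exists_d_eq i (x := u - D.twist (i + 1) b) (by
        rw [map_sub, D.d_twist, sub_neg_eq_add, hx.1])
      exact ⟨(split R _ _).symm (a, b), by simp [d_apply, ha]⟩
  minimal i := by
    rintro _ ⟨x, rfl⟩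
    obtain ⟨⟨u, v⟩, rfl⟩ := (split R _ _).symm.surjective x
    rw [mem_smul_top_iff_split]
    simp only [LinearMap.comp_apply, LinearEquiv.coe_coe, LinearEquiv.apply_symm_apply, d_apply]
    exact ⟨Submodule.add_mem _ (F.minimal i ⟨u, rfl⟩) (hD i ⟨v, rfl⟩), L.minimal i ⟨v, rfl⟩⟩

lemma linExactAt_resolution_iff (hφ : Function.Injective φ) (hφψ : Function.Exact φ ψ)
    (hD : ∀ i, LinearMap.range (D.twist i) ≤ 𝔪 • (⊤ : Submodule R (Fin (F.rank i) → R))) (i : ℕ) :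
    (D.resolution hφ hφψ hD).LinExactAt i ↔ ∀ n, ∀ u ∈ F.filt n (i + 1), ∀ v ∈ L.filt n (i + 1),
      F.d i u + D.twist i v ∈ F.filt (n + 1) i → L.d i v ∈ L.filt (n + 1) i →
      ∃ y ∈ F.filt n (i + 2), ∃ w ∈ L.filt n (i + 2),
        u - (F.d (i + 1) y + D.twist (i + 1) w) ∈ F.filt (n + 1) (i + 1) ∧
        v - L.d (i + 1) w ∈ L.filt (n + 1) (i + 1) := by
  have hfilt : ∀ {n j : ℕ} {x : Fin (F.rank j + L.rank j) → R},
      x ∈ (D.resolution hφ hφψ hD).filt n j ↔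
        (split R _ _ x).1 ∈ F.filt n j ∧ (split R _ _ x).2 ∈ L.filt n j :=
    mem_smul_top_iff_split
  have hd : ∀ (j : ℕ) (x : Fin (F.rank (j + 1) + L.rank (j + 1)) → R),
      split R _ _ ((D.resolution hφ hφψ hD).d j x) = D.d j (split R _ _ x) := fun j x =>
    LinearEquiv.apply_symm_apply _ _
  -- The `id` makes the subtraction take place in the explicit sum type, which agrees with the term
  -- of the glued resolution by definition.
  have hsub : ∀ {n j : ℕ} {x : Fin (F.rank j + L.rank j) → R}
      {y : Fin (F.rank (j + 1) + L.rank (j + 1)) → R},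
      x - (id ((D.resolution hφ hφψ hD).d j y) : Fin (F.rank j + L.rank j) → R) ∈
          (D.resolution hφ hφψ hD).filt n j ↔
        (split R _ _ x - D.d j (split R _ _ y)).1 ∈ F.filt n j ∧
        (split R _ _ x - D.d j (split R _ _ y)).2 ∈ L.filt n j := fun {n j x y} => by
    rw [← (map_sub (split R _ _) x _).trans (congrArg (split R _ _ x - ·) (hd j y))]
    exact hfilt
  refine forall_congr' fun n => ⟨fun h u hu v hv h1 h2 => ?_, fun h x hx hdx => ?_⟩
  · obtain ⟨y, hy, hxy⟩ := h ((split R _ _).symm (u, v)) (hfilt.mpr (by simp [hu, hv]))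
      (hfilt.mpr (by rw [hd]; simp [d_apply, h1, h2]))
    have hy := hfilt.mp hy
    have hxy := hsub.mp hxy
    rw [LinearEquiv.apply_symm_apply] at hxy
    exact ⟨_, hy.1, _, hy.2, hxy⟩
  · have hx := hfilt.mp hx
    have hdx := hfilt.mp hdx
    rw [hd i x] at hdx
    obtain ⟨y, hy, w, hw, h1, h2⟩ := h _ hx.1 _ hx.2 hdx.1 hdx.2
    refine ⟨(split R _ _).symm (y, w), hfilt.mpr (by simp [hy, hw]), hsub.mpr ?_⟩
    rw [LinearEquiv.apply_symm_apply]
    exact ⟨h1, h2⟩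

/-! ### Chases in the long exact sequence of linear parts. -/

section Comparison

variable (hD : ∀ i, LinearMap.range (D.twist i) ≤ 𝔪 • (⊤ : Submodule R (Fin (F.rank i) → R)))
include hD

/-- Minimality of the twist gains a factor 𝔪, which compensates for the drop of the homological
degree by one. -/
lemma twist_mem_filt {n i : ℕ} {v : Fin (L.rank (i + 1)) → R} (hv : v ∈ L.filt n (i + 1)) :
    D.twist i v ∈ F.filt n i :=
  Submodule.smul_mono_left (Ideal.pow_le_pow_right (by omega))
    (LinearMap.map_mem_pow_succ_smul_top 𝔪 (D.twist i) (hD i) _ hv)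

variable (hφ : Function.Injective φ) (hφψ : Function.Exact φ ψ)

lemma linExactAt_resolution {i : ℕ} (hF : F.LinExactAt i) (hL : L.LinExactAt i) :
    (D.resolution hφ hφψ hD).LinExactAt i := by
  rw [linExactAt_resolution_iff]
  intro n u hu v hv h1 h2
  obtain ⟨w, hw, hvw⟩ := hL n v hv h2
  -- After the boundary of (0, w) is removed, the first component is a cycle of lin F.
  obtain ⟨y, hy, huy⟩ := hF n (u - D.twist (i + 1) w)
    (Submodule.sub_mem _ hu (D.twist_mem_filt hD hw)) (by
      have := Submodule.sub_mem _ h1 (D.twist_mem_filt hD hvw)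
      rw [map_sub] at this
      rw [map_sub, D.d_twist]
      convert this using 1
      abel)
  exact ⟨y, hy, w, hw, by rwa [add_comm (F.d (i + 1) y), ← sub_sub], hvw⟩

omit hφ hφψ in
/-- The connecting step: exactness of the glued complex gives exactness of the quotient where the
twist can be lifted. -/
lemma exists_of_linExactAt_resolution {hφ : Function.Injective φ} {hφψ : Function.Exact φ ψ}
    {i : ℕ} (hG : (D.resolution hφ hφψ hD).LinExactAt i) {n : ℕ} {v : Fin (L.rank (i + 1)) → R}
    (hv : v ∈ L.filt n (i + 1)) (hdv : L.d i v ∈ L.filt (n + 1) i)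
    {y : Fin (F.rank (i + 1)) → R} (hy : y ∈ F.filt n (i + 1))
    (hvy : D.twist i v - F.d i y ∈ F.filt (n + 1) i) :
    ∃ w ∈ L.filt n (i + 2), v - L.d (i + 1) w ∈ L.filt (n + 1) (i + 1) := by
  rw [linExactAt_resolution_iff] at hG
  -- The pair (-y, v) is a cycle of the glued linear part; the second component of a bounding pair
  -- bounds v.
  obtain ⟨-, -, w, hw, -, h⟩ := hG n (-y) (Submodule.neg_mem _ hy) v hv
    (by rwa [map_neg, neg_add_eq_sub]) hdv
  exact ⟨w, hw, h⟩

/-- In homological degree at least 2 the connecting map lands in positive-degree homology of lin F,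
where exactness lifts the twist. -/
lemma linExactAt_succ_right {i : ℕ} (hF : F.LinExactAt i)
    (hG : (D.resolution hφ hφψ hD).LinExactAt (i + 1)) : L.LinExactAt (i + 1) := by
  intro n v hv hdv
  obtain ⟨y, hy, hvy⟩ := hF n (D.twist (i + 1) v) (D.twist_mem_filt hD hv) (by
    rw [D.d_twist]
    exact Submodule.neg_mem _ (D.twist_mem_filt hD hdv))
  exact D.exists_of_linExactAt_resolution hD hG hv hdv hy hvy

/-- Here the connecting map lands in H_0(lin F), which need not vanish. The intersection hypothesis
writes the twist of v as a boundary plus an element of 𝔪^(n+1)F_0, and strictness of `d 0` on F puts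
a preimage of that boundary in the right filtration step. -/
lemma linExactAt_zero_right (hF : F.LinExactAt 0)
    (hG : (D.resolution hφ hφψ hD).LinExactAt 0)
    (hs : ∀ s : ℕ, 1 ≤ s → LinearMap.range φ ⊓ 𝔪 ^ s • (⊤ : Submodule R P) =
      (𝔪 ^ s • (⊤ : Submodule R M)).map φ) : L.LinExactAt 0 := by
  intro n v hv hdv
  have h1 : φ (F.aug (D.twist 0 v)) ∈ (𝔪 ^ (n + 1) • (⊤ : Submodule R M)).map φ := by
    rw [← hs (n + 1) (by omega)]
    refine ⟨⟨_, rfl⟩, ?_⟩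
    rw [D.aug_twist]
    exact Submodule.neg_mem _ (LinearMap.map_mem_pow_smul_top 𝔪 D.aug (n + 1) hdv)
  obtain ⟨m, hm, hmv⟩ := h1
  obtain ⟨z, hz, rfl⟩ := LinearMap.exists_mem_pow_smul_top 𝔪 F.aug F.aug_surjective (n + 1) hm
  obtain ⟨y, hy⟩ := F.exists_d_zero_eq (x := D.twist 0 v - z) (by
    rw [map_sub, hφ hmv, sub_self])
  have hz' : z ∈ F.filt (n + 1) 0 := hz
  have hdy : F.d 0 y ∈ F.filt n 0 := by
    rw [hy]
    exact Submodule.sub_mem _ (D.twist_mem_filt hD hv) (F.filt_succ_le _ _ hz')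
  obtain ⟨y', hy', hyy'⟩ : ∃ y' ∈ F.filt n 1, F.d 0 y' = F.d 0 y := by
    -- Step 0 of the filtration on F_1 is everything; step n + 1 is 𝔪^n F_1, the power that
    -- strictness provides.
    rcases n with _ | n
    · exact ⟨y, F.mem_filt_of_le (Nat.zero_le _) y, rfl⟩
    · obtain ⟨y', hy', c, rfl⟩ :=
        MinimalFreeResolution.exists_eq_add_d_of_linExactAt_zero hF n y hdy
      exact ⟨y', hy', by rw [map_add, F.d_d, add_zero]⟩
  exact D.exists_of_linExactAt_resolution hD hG hv hdv hy' (by rwa [hyy', hy, sub_sub_cancel])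

omit hφ hφψ in
-- Lift an element of M' ∩ 𝔪^(s+1)P' to (p, q) in 𝔪^(s+1)(F_0 ⊕ L_0). Then q is a boundary, by
-- strictness of some b' in 𝔪^s L_1, and trading q for the twist of b', which lies in 𝔪^(s+1)F_0,
-- expresses the element through F_0 alone.
lemma range_inf_pow_smul_top (hφ : Function.Injective φ) (hφψ : Function.Exact φ ψ)
    (hL : L.LinExactAt 0) (s : ℕ) (hs : 1 ≤ s) :
    LinearMap.range φ ⊓ 𝔪 ^ s • (⊤ : Submodule R P) = (𝔪 ^ s • (⊤ : Submodule R M)).map φ := by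
  apply le_antisymm
  · rintro _ ⟨⟨m, rfl⟩, hm⟩
    obtain ⟨s, rfl⟩ := Nat.exists_eq_add_of_le' hs
    obtain ⟨u, rfl⟩ := F.aug_surjective m
    obtain ⟨g, hg, hgu⟩ := LinearMap.exists_mem_pow_smul_top 𝔪 (D.resolution hφ hφψ hD).aug
      (D.resolution hφ hφψ hD).aug_surjective (s + 1) hm
    obtain ⟨hg1, hg2⟩ := mem_smul_top_iff_split.mp hg
    replace hgu : φ (F.aug (split R _ _ g).1) + D.aug (split R _ _ g).2 = φ (F.aug u) := hgu
    generalize (split R _ _ g).1 = p at hg1 hgu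
    generalize (split R _ _ g).2 = q at hg2 hgu
    obtain ⟨b, rfl⟩ := L.exists_d_zero_eq (x := q) (by
      have := congrArg ψ hgu
      rwa [map_add, hφψ.apply_apply_eq_zero, zero_add, D.map_aug,
        hφψ.apply_apply_eq_zero] at this)
    obtain ⟨b', hb', c, rfl⟩ :=
      MinimalFreeResolution.exists_eq_add_d_of_linExactAt_zero hL s b hg2
    -- Since σ(d b') = -φ(ε(τ b')), the relation becomes φ(ε(p - τ b')) = φ(ε u).
    rw [map_add, L.d_d, add_zero, ← neg_neg (D.aug _), ← D.aug_twist, ← map_neg, ← map_neg,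
      ← map_add, ← map_add, ← sub_eq_add_neg] at hgu
    rw [← hgu]
    refine Submodule.mem_map_of_mem (LinearMap.map_mem_pow_smul_top 𝔪 F.aug (s + 1) ?_)
    exact Submodule.sub_mem _ hg1 (LinearMap.map_mem_pow_succ_smul_top 𝔪 (D.twist 0) (hD 0) s hb')
  · rintro _ ⟨m, hm, rfl⟩
    exact ⟨⟨m, rfl⟩, LinearMap.map_mem_pow_smul_top 𝔪 φ s hm⟩

end Comparison

end HorseshoeData

/-- The comparison of linearity defects in a short exact sequence, for arbitrary minimal free
resolutions with respect to an ideal. -/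
theorem MinimalFreeResolution.linDefect_shortExact {R : Type u} [CommRing R] {𝔪 : Ideal R}
    {M P N : Type v} [AddCommGroup M] [Module R M] [AddCommGroup P] [Module R P]
    [AddCommGroup N] [Module R N] (F : MinimalFreeResolution 𝔪 M) (G : MinimalFreeResolution 𝔪 P)
    (L : MinimalFreeResolution 𝔪 N) (φ : M →ₗ[R] P) (ψ : P →ₗ[R] N)
    (hφ : Function.Injective φ) (hφψ : Function.Exact φ ψ) (hψ : Function.Surjective ψ)
    (hF : F.linDefect = 0)
    (hM : LinearMap.range φ ⊓ 𝔪 • (⊤ : Submodule R P) = (𝔪 • (⊤ : Submodule R M)).map φ) :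
    (G.linDefect ≤ L.linDefect ∧ L.linDefect ≤ max G.linDefect 1) ∧
    (1 ≤ G.linDefect → L.linDefect = G.linDefect) ∧
    (G.linDefect = 0 → L.linDefect ≤ 1) ∧
    (L.linDefect = 0 ↔ G.linDefect = 0 ∧ ∀ s : ℕ, 1 ≤ s →
      LinearMap.range φ ⊓ 𝔪 ^ s • (⊤ : Submodule R P) =
        (𝔪 ^ s • (⊤ : Submodule R M)).map φ) := by
  rw [F.linDefect_eq_zero_iff] at hF
  obtain ⟨D⟩ := HorseshoeData.nonempty F L hφ hφψ hψ
  have hD := D.range_twist_le hφ hF hM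
  have hG : ∀ i, G.LinExactAt i ↔ (D.resolution hφ hφψ hD).LinExactAt i := G.linExactAt_iff _
  have h1 : G.linDefect ≤ L.linDefect := by
    rw [linDefect_le_iff]
    intro i hi
    refine (L.linDefect_le_iff _).mp le_rfl i fun h => hi ?_
    exact (hG i).mpr (D.linExactAt_resolution hD hφ hφψ (hF i) h)
  have h2 : L.linDefect ≤ max G.linDefect 1 := by
    rw [linDefect_le_iff]
    rintro (_ | i) hi
    -- Failure of exactness of lin L in homological degree 1 is absorbed by the 1 in the maximum.
    · simp
    · refine le_max_of_le_left ((G.linDefect_le_iff _).mp le_rfl (i + 1) fun h => hi ?_)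
      exact D.linExactAt_succ_right hD hφ hφψ (hF i) ((hG (i + 1)).mp h)
  refine ⟨⟨h1, h2⟩, fun h => le_antisymm (by rwa [max_eq_left h] at h2) h1,
    fun h => by simpa [h] using h2, fun h => ⟨nonpos_iff_eq_zero.mp (h1.trans h.le), ?_⟩, ?_⟩
  · exact D.range_inf_pow_smul_top hD hφ hφψ (L.linDefect_eq_zero_iff.mp h 0)
  · rintro ⟨h, hs⟩
    rw [linDefect_eq_zero_iff] at h ⊢
    rintro (_ | i)
    · exact D.linExactAt_zero_right hD hφ hφψ (hF 0) ((hG 0).mp (h 0)) hs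
    · exact D.linExactAt_succ_right hD hφ hφψ (hF i) ((hG (i + 1)).mp (h (i + 1)))

theorem theorem3p1 :
    -- the local case
    (∀ (R : Type u) [CommRing R] [IsLocalRing R] [IsNoetherianRing R]
      (M P N : Type v)
      [AddCommGroup M] [Module R M] [Module.Finite R M] [Nontrivial M]
      [AddCommGroup P] [Module R P] [Module.Finite R P] [Nontrivial P]
      [AddCommGroup N] [Module R N] [Module.Finite R N] [Nontrivial N]
      (φ : M →ₗ[R] P) (ψ : P →ₗ[R] N),
      Function.Injective φ → Function.Exact φ ψ → Function.Surjective ψ →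
      IsKoszulModule R M →
      LinearMap.range φ ⊓ IsLocalRing.maximalIdeal R • (⊤ : Submodule R P) =
        (IsLocalRing.maximalIdeal R • (⊤ : Submodule R M)).map φ →
      (lind R P ≤ lind R N ∧ lind R N ≤ max (lind R P) 1) ∧
      (1 ≤ lind R P → lind R N = lind R P) ∧
      (lind R P = 0 → lind R N ≤ 1) ∧
      (lind R N = 0 ↔ IsKoszulModule R P ∧ ∀ s : ℕ, 1 ≤ s →
        LinearMap.range φ ⊓ IsLocalRing.maximalIdeal R ^ s • (⊤ : Submodule R P) =
          (IsLocalRing.maximalIdeal R ^ s • (⊤ : Submodule R M)).map φ)) ∧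
    -- the graded case
    (∀ (k : Type w) (R : Type u) [Field k] [CommRing R] [Algebra k R]
      (𝒜 : ℕ → Submodule k R) [GradedAlgebra 𝒜] [IsStandardGraded 𝒜]
      (M P N : Type v)
      [AddCommGroup M] [Module R M] [Module.Finite R M] [Nontrivial M]
      [AddCommGroup P] [Module R P] [Module.Finite R P] [Nontrivial P]
      [AddCommGroup N] [Module R N] [Module.Finite R N] [Nontrivial N]
      (grM : ℤ → AddSubgroup M) [IsGradedModule 𝒜 grM]
      (grP : ℤ → AddSubgroup P) [IsGradedModule 𝒜 grP]
      (grN : ℤ → AddSubgroup N) [IsGradedModule 𝒜 grN]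
      (φ : M →ₗ[R] P) (ψ : P →ₗ[R] N),
      (∀ d, ∀ m ∈ grM d, φ m ∈ grP d) → (∀ d, ∀ p ∈ grP d, ψ p ∈ grN d) →
      Function.Injective φ → Function.Exact φ ψ → Function.Surjective ψ →
      IsGradedKoszulModule 𝒜 grM →
      LinearMap.range φ ⊓ gradedMaximalIdeal 𝒜 • (⊤ : Submodule R P) =
        (gradedMaximalIdeal 𝒜 • (⊤ : Submodule R M)).map φ →
      (gradedLind 𝒜 grP ≤ gradedLind 𝒜 grN ∧ gradedLind 𝒜 grN ≤ max (gradedLind 𝒜 grP) 1) ∧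
      (1 ≤ gradedLind 𝒜 grP → gradedLind 𝒜 grN = gradedLind 𝒜 grP) ∧
      (gradedLind 𝒜 grP = 0 → gradedLind 𝒜 grN ≤ 1) ∧
      (gradedLind 𝒜 grN = 0 ↔ IsGradedKoszulModule 𝒜 grP ∧ ∀ s : ℕ, 1 ≤ s →
        LinearMap.range φ ⊓ gradedMaximalIdeal 𝒜 ^ s • (⊤ : Submodule R P) =
          (gradedMaximalIdeal 𝒜 ^ s • (⊤ : Submodule R M)).map φ)) := by
  -- Both linearity defects are by definition `linDefect` of a chosen minimal resolution, so the
  -- comparison applies with 𝔪 the maximal or the irrelevant ideal.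
  refine ⟨?_, ?_⟩
  · intro R _ _ _ M P N _ _ _ _ _ _ _ _ _ _ _ _ φ ψ hφ hφψ hψ hM hMP
    exact MinimalFreeResolution.linDefect_shortExact _ _ _ φ ψ hφ hφψ hψ hM hMP
  · intro k R _ _ _ 𝒜 _ _ M P N _ _ _ _ _ _ _ _ _ _ _ _ grM _ grP _ grN _ φ ψ _ _ hφ hφψ hψ hM hMP
    exact MinimalFreeResolution.linDefect_shortExact _ _ _ φ ψ hφ hφψ hψ hM hMP
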